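/- Consider an exchange economy with consumers $i=1,\dots,N$ ($N\ge 1$) and goods $k=1,\dots,K$. Consumer $i$ has a utility function $u_i:\mathbb{R}^K_{\ge 0}\to[-\infty,\infty)$, finite at every point of $\mathbb{R}^K_{>0}$ and continuous on $\mathbb{R}^K_{\ge 0}$. Where it is finite, $u_i$ is strictly increasing (if $u_i(x)>-\infty$, $x\le y$ and $x\ne y$, then $u_i(x)<u_i(y)$), strictly concave, and differentiable in the sense that at every $x$ with $u_i(x)>-\infty$ the partial derivative $\partial u_i/\partial x_k$ exists for every $k$ with $x_k>0$. (In particular, $u_i$ may be any real-valued function that is strictly increasing, strictly concave and differentiable on $\mathbb{R}^K_{\ge 0}$.) Let $\omega_i\in\mathbb{R}^K_{>0}$ be arbitrary endowments and let $w=\sum_{i}\omega_i$. For a weight vector $\alpha\in\mathbb{R}^N_{>0}$, an allocation $x=(x_1,\dots,x_N)$ with $x_i\in\mathbb{R}^K_{\ge0}$ and $\sum_i x_i\le w$, and prices $p\in\mathbb{R}^K_{\ge 0}$, define the economy's potential $$Y_\alpha(x,p,w)=\sum_{i}\alpha_i u_i(x_i)-\Bigl(\langle p|w\rangle+\sum_i\alpha_i\,\overline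 v_i(p/\alpha_i)\Bigr),\qquad \overline v_i(q)=\sup_{y\in\mathbb{R}^K_{\ge0}}\bigl(u_i(y)-\langle q|y\rangle\bigr)\in(-\infty,\infty].$$ Then there is a weight vector $\alpha$ with $\alpha_i>0$ for all $i$ and $\sum_i\alpha_i=1$ such that $Y_\alpha(\cdot,\cdot,w)$ has exactly one root $(x,p)$ among the feasible allocations and nonnegative prices, and this root is a Walrasian equilibrium for the endowments $\omega_1,\dots,\omega_N$: for every $i$ the bundle $x_i$ maximizes $u_i$ over $\{y\in\mathbb{R}^K_{\ge0}:\langle p|y\rangle\le\langle p|\omega_i\rangle\}$, and $\sum_i x_i=\sum_i\omega_i$. -/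

import Mathlib

/-- The standing assumptions on a utility function `u` on the nonnegative orthant of `ℝ^K`
(values outside the orthant are irrelevant). The value `⊥ = -∞` is allowed on the boundary of
the orthant, so that Cobb–Douglas and CES utilities are included. A real-valued function that is
strictly increasing, strictly concave and differentiable on the orthant is a special case. -/
structure IsUtility {K : ℕ} (u : (Fin K → ℝ) → EReal) : Prop where
  /-- no bundle has infinite positive utility -/
  lt_top : ∀ x, 0 ≤ x → u x < ⊤
  /-- bundles containing a positive amount of every good have finite utility -/
  finite_of_pos : ∀ x, (∀ k, 0 < x k) → ⊥ < u x
  /-- continuity on the orthant, for the order topology on the extended reals -/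
  continuousOn : ContinuousOn u {x | 0 ≤ x}
  /-- strictly increasing (in the product order) wherever finite -/
  strictlyIncreasing : ∀ x y, 0 ≤ x → ⊥ < u x → x < y → u x < u y
  /-- strictly concave wherever finite -/
  strictlyConcave : ∀ x y, 0 ≤ x → 0 ≤ y → ⊥ < u x → ⊥ < u y → x ≠ y →
    ∀ a b : ℝ, 0 < a → 0 < b → a + b = 1 →
      (a : EReal) * u x + (b : EReal) * u y < u (a • x + b • y)
  /-- wherever `u` is finite, its partial derivative exists in every good consumed in a positive
  amount (`u` is finite near `x` on the line considered, by continuity). At interior points this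
  is differentiability, since `u` is concave; marginal utility may be infinite at zero
  consumption. -/
  differentiable : ∀ x, 0 ≤ x → ⊥ < u x → ∀ k, 0 < x k →
    DifferentiableAt ℝ (fun t : ℝ => (u (Function.update x k t)).toReal) (x k)

/-- The total amounts `w_k = ∑ i, ω_{ik}` of the goods. -/
def totalEndowment {N K : ℕ} (ω : Fin N → Fin K → ℝ) : Fin K → ℝ :=
  ∑ i, ω i

/-- The set `F(w)` of feasible allocations. -/
def feasible {N K : ℕ} (w : Fin K → ℝ) : Set (Fin N → Fin K → ℝ) :=
  {x | (∀ i, 0 ≤ x i) ∧ ∀ k, ∑ i, x i k ≤ w k}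

/-- The Fenchel dual `sup_{x ≥ 0} (u(x) - ⟨p|x⟩)`, with values in the extended reals. -/
noncomputable def fenchelDual {K : ℕ} (u : (Fin K → ℝ) → EReal) (p : Fin K → ℝ) : EReal :=
  ⨆ x ∈ {x : Fin K → ℝ | 0 ≤ x}, (u x - ((p ⬝ᵥ x : ℝ) : EReal))

/-- Weighted aggregate utility `U_α(x)`. -/
noncomputable def weightedUtility {N K : ℕ} (u : Fin N → (Fin K → ℝ) → EReal) (α : Fin N → ℝ)
    (x : Fin N → Fin K → ℝ) : EReal :=
  ∑ i, (α i : EReal) * u i (x i)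

/-- The dual objective `V_α(p, w) = ⟨p|w⟩ + ∑ i, α_i v̄_i(p / α_i)`, for positive weights. -/
noncomputable def dualWelfare {N K : ℕ} (u : Fin N → (Fin K → ℝ) → EReal) (α : Fin N → ℝ)
    (p w : Fin K → ℝ) : EReal :=
  ((p ⬝ᵥ w : ℝ) : EReal) + ∑ i, (α i : EReal) * fenchelDual (u i) ((α i)⁻¹ • p)

/-- The economy's potential `Y_α(x, p, w) = U_α(x) - V_α(p, w)`. -/
noncomputable def potential {N K : ℕ} (u : Fin N → (Fin K → ℝ) → EReal) (α : Fin N → ℝ)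
    (x : Fin N → Fin K → ℝ) (p w : Fin K → ℝ) : EReal :=
  weightedUtility u α x - dualWelfare u α p w

/-- `(x, p)` is a root of the potential `Y_α(·, ·, w)`, whose arguments are the feasible
allocations and the nonnegative price vectors. -/
def IsPotentialRoot {N K : ℕ} (u : Fin N → (Fin K → ℝ) → EReal) (α : Fin N → ℝ)
    (w : Fin K → ℝ) (x : Fin N → Fin K → ℝ) (p : Fin K → ℝ) : Prop :=
  x ∈ feasible w ∧ 0 ≤ p ∧ potential u α x p w = 0

/-- `(x, p)` is a Walrasian equilibrium for the endowments `ω`: prices are nonnegative, every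
consumer's bundle maximizes her utility over her budget set at income `⟨p|ω_i⟩`, and all markets
clear. -/
structure IsWalrasianEquilibrium {N K : ℕ} (u : Fin N → (Fin K → ℝ) → EReal)
    (ω : Fin N → Fin K → ℝ) (x : Fin N → Fin K → ℝ) (p : Fin K → ℝ) : Prop where
  price_nonneg : 0 ≤ p
  bundle_nonneg : ∀ i, 0 ≤ x i
  budget : ∀ i, p ⬝ᵥ x i ≤ p ⬝ᵥ ω i
  optimal : ∀ i (y : Fin K → ℝ), 0 ≤ y → p ⬝ᵥ y ≤ p ⬝ᵥ ω i → u i y ≤ u i (x i)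
  market_clearing : ∑ i, x i = totalEndowment ω

/-! The weights are Negishi weights. At a Walrasian equilibrium, concavity gives each consumer a
multiplier `l i > 0`, the marginal utility of income, such that `x i` maximizes `u i y - l i * (p ⬝ᵥ
y)` over the whole orthant (`IsUtility.exists_multiplier`). Take weights proportional to `(l i)⁻¹`
and rescale the prices by the same constant: every bundle then attains the supremum in its Fenchel
dual, and market clearing makes the potential vanish.

Conversely, summing the Fenchel–Young inequalities over consumers shows that a root forces equality
in each of them (`IsPotentialRoot.isSupported`). The allocations of two roots therefore have equal
welfare, and strict concavity makes them coincide. Each good is used up, hence consumed by somebody,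
whose partial derivative fixes its price.

For existence of an equilibrium, strict concavity makes demand in a large box a continuous function
of prices. The Gale–Nikaido–Debreu lemma yields prices without excess demand, and monotonicity turns
this into market clearing at positive prices. That lemma rests on Brouwer's theorem, derived here
from Scarf's lemma, which is a parity count. -/

/-- A finite set `σ` is dominant for the families of keys `f i` if no point of the ambient type
exceeds, for every `i`, the least key of `σ`. -/
def Dominant {I V : Type*} (f : I → V → ℕ) (σ : Finset V) : Prop :=
  ∀ y, ∃ i, ∀ x ∈ σ, f i y ≤ f i x

theorem Dominant.mono {I V : Type*} {f : I → V → ℕ} {σ τ : Finset V} (h : Dominant f σ)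
    (hτ : τ ⊆ σ) : Dominant f τ := fun y => by
  obtain ⟨i, hi⟩ := h y
  exact ⟨i, fun x hx => hi x (hτ hx)⟩

/-! ### Scarf's combinatorial lemma. -/

section Scarf

variable {I V : Type*} [Fintype I]

/-- A choice of minimizers over a dominant set covers the whole set. -/
theorem Dominant.exists_minimizers [DecidableEq V] {f : I → V → ℕ} (hf : ∀ i, Function.Injective (f i))
    {σ : Finset V} (h : Dominant f σ) (hσ : σ.Nonempty) :
    ∃ m : I → V, (∀ i, m i ∈ σ) ∧ (∀ i, ∀ x ∈ σ, f i (m i) ≤ f i x) ∧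
      Finset.univ.image m = σ := by
  choose m hm hmin using fun i => Finset.exists_min_image σ (f i) hσ
  refine ⟨m, hm, hmin, ?_⟩
  ext x
  simp only [Finset.mem_image, Finset.mem_univ, true_and]
  constructor
  · rintro ⟨i, rfl⟩
    exact hm i
  · intro hx
    obtain ⟨i, hi⟩ := h x
    exact ⟨i, hf i (le_antisymm (hmin i x hx) (hi _ (hm i)))⟩

theorem exists_collision [DecidableEq V] {m : I → V} {τ : Finset V} (hm : Finset.univ.image m = τ)
    (hcard : τ.card + 1 = Fintype.card I) :
    ∃ a b, a ≠ b ∧ m a = m b := by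
  by_contra! hne
  have : Function.Injective m := fun a b hab => by
    by_contra h
    exact hne a b h hab
  have h2 := Finset.card_image_of_injective Finset.univ this
  rw [hm, Finset.card_univ] at h2
  omega

/-- `x` is the point with the largest key `f a` among those exceeding the minimizers `m i` in
every key `f i` with `i ≠ a`. -/
def IsReplacement (f : I → V → ℕ) (m : I → V) (a : I) (x : V) : Prop :=
  (∀ i, i ≠ a → f i (m i) < f i x) ∧ ∀ y, (∀ i, i ≠ a → f i (m i) < f i y) → f a y ≤ f a x

theorem exists_isReplacement [Fintype V] {f : I → V → ℕ} {m : I → V} {a : I} {y : V}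
    (hy : ∀ i, i ≠ a → f i (m i) < f i y) : ∃ x, IsReplacement f m a x := by
  classical
  obtain ⟨x, hx, hmax⟩ := Finset.exists_max_image
    (Finset.univ.filter fun y => ∀ i, i ≠ a → f i (m i) < f i y) (f a) ⟨y, by simpa using hy⟩
  simp only [Finset.mem_filter, Finset.mem_univ, true_and] at hx hmax
  exact ⟨x, hx, hmax⟩

/-- Since `m a = m b`, the minimizers with index other than `a` already cover `τ`. As `x` beats all
of them, dominance of `τ` at `x` can only hold through key `a`, so `x` becomes the new minimizer
there; its maximality handles the points that also beat the other minimizers. -/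
theorem dominant_insert_of_isReplacement [DecidableEq V] {f : I → V → ℕ} {τ : Finset V} (hτ : Dominant f τ)
    {m : I → V} (hmem : ∀ i, m i ∈ τ) (hmin : ∀ i, ∀ x ∈ τ, f i (m i) ≤ f i x)
    (himg : Finset.univ.image m = τ) {a b : I} (hab : a ≠ b) (hm : m a = m b) {x : V}
    (hx : IsReplacement f m a x) : x ∉ τ ∧ Dominant f (insert x τ) := by
  constructor
  · intro hxτ
    rw [← himg] at hxτ
    obtain ⟨i, -, rfl⟩ := Finset.mem_image.1 hxτ
    by_cases hi : i = a
    · subst hi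
      have := hx.1 b hab.symm
      rw [hm] at this
      exact lt_irrefl _ this
    · exact lt_irrefl _ (hx.1 i hi)
  · intro y
    have hax : ∀ z ∈ τ, f a x ≤ f a z := by
      obtain ⟨i, hi⟩ := hτ x
      by_cases hia : i = a
      · rwa [hia] at hi
      · exact absurd (hx.1 i hia) (not_lt.2 (hi _ (hmem i)))
    by_cases hy : ∀ i, i ≠ a → f i (m i) < f i y
    · refine ⟨a, fun z hz => ?_⟩
      rcases Finset.mem_insert.1 hz with rfl | hz
      · exact hx.2 y hy
      · exact (hx.2 y hy).trans (hax z hz)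
    · push Not at hy
      obtain ⟨i, hia, hi⟩ := hy
      refine ⟨i, fun z hz => ?_⟩
      rcases Finset.mem_insert.1 hz with rfl | hz
      · exact hi.trans (hx.1 i hia).le
      · exact hi.trans (hmin i z hz)

/-- By cardinality the minimizers of the enlarged set are distinct. So `x` takes over exactly one
key and the others keep their minimizers; the key must be `a` or `b`, or else the collision would
persist. -/
theorem isReplacement_of_dominant_insert [DecidableEq V] {f : I → V → ℕ} (hf : ∀ i, Function.Injective (f i))
    {τ : Finset V} (hcard : τ.card + 1 = Fintype.card I)
    {m : I → V} (hmem : ∀ i, m i ∈ τ) (hmin : ∀ i, ∀ x ∈ τ, f i (m i) ≤ f i x)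
    {a b : I} (hab : a ≠ b) (hm : m a = m b) {x : V}
    (hx : x ∉ τ) (hd : Dominant f (insert x τ)) :
    IsReplacement f m a x ∨ IsReplacement f m b x := by
  obtain ⟨m', hmem', hmin', himg'⟩ := hd.exists_minimizers hf (Finset.insert_nonempty _ _)
  have hinj : Function.Injective m' := by
    have h1 : (Finset.univ.image m').card = (Finset.univ : Finset I).card := by
      rw [himg', Finset.card_insert_of_notMem hx, hcard, Finset.card_univ]
    have := Finset.card_image_iff.1 h1
    simpa [Set.injOn_univ] using this
  obtain ⟨j, hj⟩ : ∃ j, m' j = x := by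
    have : x ∈ Finset.univ.image m' := himg' ▸ Finset.mem_insert_self _ _
    simpa using this
  have heq : ∀ i, i ≠ j → m' i = m i := fun i hi => by
    have h1 : m' i ∈ τ := by
      rcases Finset.mem_insert.1 (hmem' i) with h | h
      · exact absurd (hinj (h.trans hj.symm)) hi
      · exact h
    exact hf i (le_antisymm (hmin' i _ (Finset.mem_insert_of_mem (hmem i))) (hmin i _ h1))
  have hrep : IsReplacement f m j x := by
    constructor
    · intro i hi
      refine lt_of_le_of_ne ?_ fun h => hx (hf i h ▸ hmem i)
      rw [← heq i hi]
      exact hmin' i x (Finset.mem_insert_self _ _)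
    · intro y hy
      obtain ⟨i, hi⟩ := hd y
      by_cases hij : i = j
      · subst hij
        exact hi x (Finset.mem_insert_self _ _)
      · exact absurd (hy i hij) (not_lt.2 (hi _ (Finset.mem_insert_of_mem (hmem i))))
  by_cases ha : a = j
  · exact Or.inl (ha ▸ hrep)
  by_cases hb : b = j
  · exact Or.inr (hb ▸ hrep)
  · exact absurd (hinj ((heq a ha).trans (hm.trans (heq b hb).symm))) hab

open Classical in
/-- A dominant set of size `|I| - 1` that contains a non-slack point extends in exactly two ways
to a dominant set of size `|I|`. -/
theorem card_extensions_eq_two [Fintype V] [DecidableEq V] {f : I → V → ℕ} (hf : ∀ i, Function.Injective (f i)) {s : I → V}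
    (htop : ∀ v, v ∉ Set.range s → ∀ i j, i ≠ j → f i v < f i (s j))
    {τ : Finset V} (hτ : Dominant f τ) (hcard : τ.card + 1 = Fintype.card I)
    {t : V} (ht : t ∈ τ) (hts : t ∉ Set.range s) :
    (Finset.univ.filter fun x => x ∉ τ ∧ Dominant f (insert x τ)).card = 2 := by
  obtain ⟨m, hmem, hmin, himg⟩ := hτ.exists_minimizers hf ⟨t, ht⟩
  obtain ⟨a, b, hab, hm⟩ := exists_collision himg hcard
  -- The slack point `s c` is a candidate: it exceeds the non-slack `t`, hence the minimizers, in
  -- every key but `c`.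
  have hex : ∀ c, ∃ x, IsReplacement f m c x := fun c =>
    exists_isReplacement (y := s c) fun i hi =>
      (hmin i t ht).trans_lt (htop t hts i c hi)
  obtain ⟨x, hx⟩ := hex a
  obtain ⟨y, hy⟩ := hex b
  have huniq : ∀ c x x', IsReplacement f m c x → IsReplacement f m c x' → x = x' :=
    fun c x x' h h' => hf c (le_antisymm (h'.2 x h.1) (h.2 x' h'.1))
  have hxy : x ≠ y := by
    rintro rfl
    obtain ⟨i, hi⟩ := hτ x
    by_cases hia : i = a
    · subst hia
      exact absurd (hy.1 i hab) (not_lt.2 (hi _ (hmem i)))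
    · exact absurd (hx.1 i hia) (not_lt.2 (hi _ (hmem i)))
  rw [Finset.card_eq_two]
  refine ⟨x, y, hxy, ?_⟩
  ext z
  simp only [Finset.mem_filter, Finset.mem_univ, true_and, Finset.mem_insert,
    Finset.mem_singleton]
  constructor
  · rintro ⟨h1, h2⟩
    rcases isReplacement_of_dominant_insert hf hcard hmem hmin hab hm h1 h2 with h | h
    · exact Or.inl (huniq a _ _ h hx)
    · exact Or.inr (huniq b _ _ h hy)
  · rintro (rfl | rfl)
    · exact dominant_insert_of_isReplacement hτ hmem hmin himg hab hm hx
    · exact dominant_insert_of_isReplacement hτ hmem hmin himg hab.symm hm.symm hy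

open Classical in
/-- The set of all slack points but one extends in exactly one way. -/
theorem card_extensions_slack_eq_one [DecidableEq I] [Fintype V] [DecidableEq V] {f : I → V → ℕ} (hf : ∀ i, Function.Injective (f i))
    {s : I → V} (hbot : ∀ i v, f i (s i) ≤ f i v)
    (htop : ∀ v, v ∉ Set.range s → ∀ i j, i ≠ j → f i v < f i (s j))
    (hs : Function.Injective s) (i₀ : I) :
    (Finset.univ.filter fun x => x ∉ (Finset.univ.erase i₀).image s ∧
      Dominant f (insert x ((Finset.univ.erase i₀).image s))).card = 1 := by
  set τ := (Finset.univ.erase i₀).image s with hτ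
  have hmem : ∀ i, i ≠ i₀ → s i ∈ τ := fun i hi =>
    Finset.mem_image_of_mem s (Finset.mem_erase.2 ⟨hi, Finset.mem_univ i⟩)
  have h0 : s i₀ ∉ τ := by
    intro h
    obtain ⟨i, hi, hi'⟩ := Finset.mem_image.1 h
    exact (Finset.mem_erase.1 hi).1 (hs hi')
  -- Every key other than `i₀` already has its global minimum in `τ`, so only key `i₀` can dominate
  -- a point outside `τ`. The added point must therefore have the largest such key.
  obtain ⟨x, hx, hmax⟩ := Finset.exists_max_image (Finset.univ.filter fun y => y ∉ τ) (f i₀)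
    ⟨s i₀, by simpa using h0⟩
  simp only [Finset.mem_filter, Finset.mem_univ, true_and] at hx hmax
  rw [Finset.card_eq_one]
  refine ⟨x, ?_⟩
  ext z
  simp only [Finset.mem_filter, Finset.mem_univ, true_and, Finset.mem_singleton]
  constructor
  · rintro ⟨hz, hd⟩
    obtain ⟨i, hi⟩ := hd x
    by_cases hii : i = i₀
    · subst hii
      exact hf i (le_antisymm (hmax z hz) (hi z (Finset.mem_insert_self _ _)))
    · have := hi _ (Finset.mem_insert_of_mem (hmem i hii))
      exact absurd (hf i (le_antisymm this (hbot i x)) ▸ hmem i hii) hx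
  · rintro rfl
    refine ⟨hx, fun y => ?_⟩
    by_cases hy : y ∈ τ
    · obtain ⟨i, -, rfl⟩ := Finset.mem_image.1 hy
      exact ⟨i, fun v _ => hbot i v⟩
    · refine ⟨i₀, fun v hv => ?_⟩
      rcases Finset.mem_insert.1 hv with rfl | hv
      · exact hmax y hy
      · refine (hmax y hy).trans ?_
        by_cases hzs : z ∈ Set.range s
        · obtain ⟨i, rfl⟩ := hzs
          have : i = i₀ := by
            by_contra h
            exact hx (hmem i h)
          subst this
          exact hbot _ _
        · obtain ⟨j, hj, rfl⟩ := Finset.mem_image.1 hv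
          exact (htop z hzs i₀ j (Finset.mem_erase.1 hj).1.symm).le

/-- A set of size `|I|` that does not carry all colours has an even number of points whose removal
leaves exactly the colours other than `i₀`. -/
theorem even_card_removable [DecidableEq I] [DecidableEq V] (c : V → I) (i₀ : I) {σ : Finset V}
    (hcard : σ.card = Fintype.card I) (hc : σ.image c ≠ Finset.univ) :
    Even (σ.filter fun x => (σ.erase x).image c = Finset.univ.erase i₀).card := by
  rcases (σ.filter fun x => (σ.erase x).image c = Finset.univ.erase i₀).eq_empty_or_nonempty
    with h | ⟨x, hx⟩
  · simp [h]
  obtain ⟨hxσ, hx⟩ := Finset.mem_filter.1 hx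
  have hinj : ∀ z ∈ σ, (σ.erase z).image c = Finset.univ.erase i₀ →
      Set.InjOn c (σ.erase z : Finset V) := by
    intro z hz h
    rw [← Finset.card_image_iff, h, Finset.card_erase_of_mem (Finset.mem_univ _),
      Finset.card_erase_of_mem hz, hcard, Finset.card_univ]
  have hcx : c x ≠ i₀ := by
    intro h
    apply hc
    rw [← Finset.insert_erase hxσ, Finset.image_insert, hx, h,
      Finset.insert_erase (Finset.mem_univ _)]
  -- The colour of `x` occurs exactly once more, at `y`; only these two points can be removed
  -- without losing a colour.
  obtain ⟨y, hy, hyx⟩ : ∃ y ∈ σ.erase x, c y = c x := by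
    have : c x ∈ (σ.erase x).image c := by
      rw [hx]
      exact Finset.mem_erase.2 ⟨hcx, Finset.mem_univ _⟩
    simpa using this
  obtain ⟨hne, hyσ⟩ := Finset.mem_erase.1 hy
  have : (σ.filter fun x => (σ.erase x).image c = Finset.univ.erase i₀) = {x, y} := by
    ext z
    simp only [Finset.mem_filter, Finset.mem_insert, Finset.mem_singleton]
    constructor
    · rintro ⟨hz, h⟩
      by_contra! hzxy
      exact hne (hinj z hz h (by simpa using ⟨hyσ, hzxy.2.symm⟩)
        (by simpa using ⟨hxσ, hzxy.1.symm⟩) hyx)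
    · rintro (rfl | rfl)
      · exact ⟨hxσ, hx⟩
      · refine ⟨hyσ, ?_⟩
        rw [← hx]
        ext i
        simp only [Finset.mem_image, Finset.mem_erase]
        constructor
        · rintro ⟨v, ⟨hv1, hv2⟩, rfl⟩
          by_cases hvx : v = x
          · exact ⟨z, ⟨hne, hyσ⟩, by rw [hvx, hyx]⟩
          · exact ⟨v, ⟨hvx, hv2⟩, rfl⟩
        · rintro ⟨v, ⟨hv1, hv2⟩, rfl⟩
          by_cases hvy : v = z
          · exact ⟨x, ⟨hne.symm, hxσ⟩, by rw [hvy, hyx]⟩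
          · exact ⟨v, ⟨hvy, hv2⟩, rfl⟩
  rw [this, Finset.card_pair hne.symm]
  exact even_two

/-- **Scarf's lemma**: some dominant set of size `|I|` carries all colours. -/
theorem exists_dominant_colorful [DecidableEq I] [Fintype V] [DecidableEq V] [Nonempty I] {f : I → V → ℕ}
    (hf : ∀ i, Function.Injective (f i))
    {s : I → V} (hbot : ∀ i v, f i (s i) ≤ f i v)
    (htop : ∀ v, v ∉ Set.range s → ∀ i j, i ≠ j → f i v < f i (s j))
    (c : V → I) (hc : ∀ i, c (s i) = i) :
    ∃ σ : Finset V, Dominant f σ ∧ σ.card = Fintype.card I ∧ σ.image c = Finset.univ := by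
  classical
  by_contra! hno
  obtain ⟨i₀⟩ := ‹Nonempty I›
  have hs : Function.Injective s := fun i j h => by rw [← hc i, h, hc]
  set D : Finset (Finset V) := Finset.univ.filter fun τ =>
    Dominant f τ ∧ τ.card + 1 = Fintype.card I ∧ τ.image c = Finset.univ.erase i₀ with hD
  set R : Finset (Finset V) := Finset.univ.filter fun σ =>
    Dominant f σ ∧ σ.card = Fintype.card I with hR
  -- Double count pairs of a small set in `D` and a point extending it. Without a colourful set the
  -- count by large sets is even, while by small sets it is odd: `τ₀` contributes one and every
  -- other member of `D` two.
  have key : (D.sigma fun τ => Finset.univ.filter fun x =>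
        x ∉ τ ∧ Dominant f (insert x τ)).card
      = (R.sigma fun σ => σ.filter fun x =>
        (σ.erase x).image c = Finset.univ.erase i₀).card := by
    refine Finset.card_bij' (fun q _ => ⟨insert q.2 q.1, q.2⟩) (fun q _ => ⟨q.1.erase q.2, q.2⟩)
      ?_ ?_ ?_ ?_
    · rintro ⟨τ, x⟩ h
      simp only [hD, hR, Finset.mem_sigma, Finset.mem_filter, Finset.mem_univ, true_and] at h ⊢
      obtain ⟨⟨_, h2, h3⟩, h4, h5⟩ := h
      refine ⟨⟨h5, ?_⟩, Finset.mem_insert_self _ _, ?_⟩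
      · rw [Finset.card_insert_of_notMem h4, h2]
      · rw [Finset.erase_insert h4, h3]
    · rintro ⟨σ, x⟩ h
      simp only [hD, hR, Finset.mem_sigma, Finset.mem_filter, Finset.mem_univ, true_and] at h ⊢
      obtain ⟨⟨h1, h2⟩, h3, h4⟩ := h
      refine ⟨⟨h1.mono (Finset.erase_subset _ _), ?_, h4⟩, Finset.notMem_erase _ _, ?_⟩
      · rw [Finset.card_erase_add_one h3, h2]
      · rwa [Finset.insert_erase h3]
    · rintro ⟨τ, x⟩ h
      simp only [Finset.mem_sigma, Finset.mem_filter, Finset.mem_univ, true_and] at h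
      simp [Finset.erase_insert h.2.1]
    · rintro ⟨σ, x⟩ h
      simp only [Finset.mem_sigma, Finset.mem_filter] at h
      simp [Finset.insert_erase h.2.1]
  rw [Finset.card_sigma, Finset.card_sigma] at key
  have heven : Even (∑ σ ∈ R, (σ.filter fun x =>
      (σ.erase x).image c = Finset.univ.erase i₀).card) := by
    refine Finset.even_sum _ fun σ hσ => ?_
    obtain ⟨-, h1, h2⟩ := Finset.mem_filter.1 hσ
    exact even_card_removable c i₀ h2 (hno σ h1 h2)
  rw [← key] at heven
  set τ₀ := (Finset.univ.erase i₀).image s with hτ₀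
  have hmem : τ₀ ∈ D := by
    refine Finset.mem_filter.2 ⟨Finset.mem_univ _, ?_, ?_, ?_⟩
    · obtain ⟨x, hx⟩ := Finset.card_pos.1
        (Nat.lt_of_lt_of_eq zero_lt_one (card_extensions_slack_eq_one hf hbot htop hs i₀).symm)
      exact (Finset.mem_filter.1 hx).2.2.mono (Finset.subset_insert _ _)
    · rw [hτ₀, Finset.card_image_of_injective _ hs, Finset.card_erase_add_one (Finset.mem_univ _),
        Finset.card_univ]
    · rw [hτ₀, Finset.image_image]
      rw [show c ∘ s = id from funext hc, Finset.image_id]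
  rw [← Finset.add_sum_erase _ _ hmem, card_extensions_slack_eq_one hf hbot htop hs i₀] at heven
  have h2 : Even (∑ τ ∈ D.erase τ₀, (Finset.univ.filter fun x =>
      x ∉ τ ∧ Dominant f (insert x τ)).card) := by
    refine Finset.even_sum _ fun τ hτ => ?_
    obtain ⟨hne, hτ⟩ := Finset.mem_erase.1 hτ
    obtain ⟨-, h1, h2, h3⟩ := Finset.mem_filter.1 hτ
    -- A set in `D` made of slack points only is determined by its colours, hence equals `τ₀`.
    obtain ⟨t, ht, hts⟩ : ∃ t ∈ τ, t ∉ Set.range s := by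
      by_contra! hall
      apply hne
      have hsc : ∀ v ∈ τ, s (c v) = v := fun v hv => by
        obtain ⟨i, rfl⟩ := hall v hv
        rw [hc]
      rw [hτ₀, ← h3, Finset.image_image]
      ext v
      simp only [Finset.mem_image, Function.comp]
      exact ⟨fun hv => ⟨v, hv, hsc v hv⟩, fun ⟨w, hw, h⟩ => h ▸ (hsc w hw).symm ▸ hw⟩
    rw [card_extensions_eq_two hf htop h1 h2 ht hts]
    exact even_two
  rw [Nat.even_add] at heven
  exact absurd (heven.2 h2) Nat.not_even_one

end Scarf

/-! ### Brouwer's fixed point theorem on the simplex. -/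

section Brouwer

variable {I : Type*} [Fintype I] [Nonempty I]

/-- Scarf's lemma on the grid of points with natural coordinates of sum `m`: in every colouring
there is a point near which each colour occurs, except colours whose coordinate is small. -/
theorem exists_grid_point_near_colors [DecidableEq I] (m : ℕ) (c : (I → ℕ) → I) :
    ∃ x : I → ℕ, ∑ i, x i = m ∧ ∀ i, x i ≤ Fintype.card I ∨
      ∃ y : I → ℕ, ∑ i, y i = m ∧ c y = i ∧
        ∀ j, y j ≤ x j + Fintype.card I ∧ x j ≤ y j + Fintype.card I := by
  classical
  let G := {g : I → ℕ // g ∈ Finset.piAntidiag (Finset.univ : Finset I) m}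
  have hG : ∀ g : G, ∑ i, g.1 i = m := fun g => (Finset.mem_piAntidiag.1 g.2).1
  have hGle : ∀ (g : G) i, g.1 i ≤ m := fun g i =>
    (Finset.single_le_sum (fun _ _ => Nat.zero_le _) (Finset.mem_univ i)).trans_eq (hG g)
  have mkG : ∀ g : I → ℕ, ∑ i, g i = m → ∃ g' : G, g'.1 = g := fun g h =>
    ⟨⟨g, Finset.mem_piAntidiag.2 ⟨h, by simp⟩⟩, rfl⟩
  let V := G ⊕ I
  -- Grid keys lie in `1, ..., m + 1`, strictly between the slack values `0` and `m + 2`.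
  let base : I → V → ℕ := fun i v => Sum.elim (fun g => g.1 i + 1)
    (fun j => if i = j then 0 else m + 2) v
  let e : V ≃ Fin (Fintype.card V) := Fintype.equivFin V
  -- Ties of `base` are broken by an enumeration of `V`, used as a lower-order digit.
  let f : I → V → ℕ := fun i v => base i v * Fintype.card V + e v
  have hfe : ∀ i v, f i v = base i v * Fintype.card V + e v := fun _ _ => rfl
  have hf : ∀ i, Function.Injective (f i) := fun i v v' h => by
    have h1 := congrArg (· % Fintype.card V) h
    simp only [hfe, Nat.mul_add_mod_self_right, Nat.mod_eq_of_lt (e _).2] at h1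
    exact e.injective (Fin.ext h1)
  have hlt : ∀ i v v', base i v < base i v' → f i v < f i v' := fun i v v' h => by
    have h1 := Nat.mul_le_mul_right (Fintype.card V) (Nat.succ_le_of_lt h)
    have h2 := (e v).2
    rw [Nat.succ_mul] at h1
    rw [hfe, hfe]
    omega
  have hle : ∀ i v v', f i v ≤ f i v' → base i v ≤ base i v' := fun i v v' h => by
    by_contra! h'
    exact absurd (hlt i _ _ h') (not_lt.2 h)
  obtain ⟨σ, hσd, -, hσc⟩ := exists_dominant_colorful (f := f) hf (s := Sum.inr)
    (fun i v => by
      rcases v with g | j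
      · exact (hlt _ _ _ (by simp [base])).le
      · by_cases h : i = j
        · rw [h]
        · exact (hlt _ _ _ (by simp [base, h])).le)
    (fun v hv i j hij => by
      rcases v with g | k
      · refine hlt _ _ _ ?_
        have := hGle g i
        simp only [base, Sum.elim_inl, Sum.elim_inr, hij, if_false]
        omega
      · exact absurd ⟨k, rfl⟩ hv)
    (Sum.elim (fun g => c g.1) id) (fun i => rfl)
  set C : Finset I := Finset.univ.filter fun i => Sum.inr i ∉ σ with hC
  have hmemC : ∀ i, i ∈ C ↔ (Sum.inr i : V) ∉ σ := fun i => by simp [hC]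
  have hcol : ∀ i ∈ C, ∃ g : G, (Sum.inl g : V) ∈ σ ∧ c g.1 = i := fun i hi => by
    have : i ∈ σ.image (Sum.elim (fun g : G => c g.1) id) := by
      rw [hσc]
      exact Finset.mem_univ i
    obtain ⟨v, hv, hvi⟩ := Finset.mem_image.1 this
    rcases v with g | j
    · exact ⟨g, hv, hvi⟩
    · obtain rfl : j = i := hvi
      exact absurd hv ((hmemC j).1 hi)
  have hdom : ∀ y : I → ℕ, ∑ i, y i = m → ∃ i ∈ C, ∀ g : G, (Sum.inl g : V) ∈ σ → y i ≤ g.1 i := by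
    intro y hy
    obtain ⟨y, rfl⟩ := mkG y hy
    obtain ⟨i, hi⟩ := hσd (Sum.inl y)
    refine ⟨i, (hmemC i).2 fun h => ?_, fun g hg => ?_⟩
    · have := hle _ _ _ (hi _ h)
      simp [base] at this
    · have := hle _ _ _ (hi _ hg)
      simpa [base] using this
  obtain ⟨i₁, hi₁, -⟩ := hdom (Pi.single (Classical.arbitrary I) m) (by simp)
  obtain ⟨x, hx, hxi⟩ := hcol i₁ hi₁
  have hmin : ∀ i, ∃ g : G, (Sum.inl g : V) ∈ σ ∧ ∀ g' : G, (Sum.inl g' : V) ∈ σ →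
      g.1 i ≤ g'.1 i := fun i => by
    obtain ⟨g, hg, h⟩ := Finset.exists_min_image
      (Finset.univ.filter fun g : G => (Sum.inl g : V) ∈ σ) (fun g => g.1 i)
      ⟨x, by simpa using hx⟩
    simp only [Finset.mem_filter, Finset.mem_univ, true_and] at hg h
    exact ⟨g, hg, h⟩
  choose μ hμ hμmin using hmin
  -- Otherwise some grid point exceeds all the minima over `C`, the surplus being placed at `i₁`,
  -- against dominance. So these minima sum to within `C.card` of `m`, which confines the grid
  -- points of `σ` to a small box.
  have hsum : m < ∑ i ∈ C, ((μ i).1 i + 1) := by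
    by_contra! hcon
    let y : I → ℕ := fun i => (if i ∈ C then (μ i).1 i + 1 else 0) +
      (if i = i₁ then m - ∑ i ∈ C, ((μ i).1 i + 1) else 0)
    obtain ⟨i, hi, h⟩ := hdom y (by
      simp only [y, Finset.sum_add_distrib, Finset.sum_ite_mem, Finset.univ_inter,
        Finset.sum_ite_eq', Finset.mem_univ, if_true]
      rw [← Finset.sum_add_distrib]
      omega)
    have := h _ (hμ i)
    simp only [y, hi, if_true] at this
    omega
  rw [Finset.sum_add_distrib, Finset.sum_const, smul_eq_mul, mul_one] at hsum
  have hCn : C.card ≤ Fintype.card I := Finset.card_le_univ C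
  have hclose : ∀ g : G, (Sum.inl g : V) ∈ σ →
      ∀ j, (if j ∈ C then (μ j).1 j else 0) ≤ g.1 j ∧
        g.1 j ≤ (if j ∈ C then (μ j).1 j else 0) + Fintype.card I := fun g hg => by
    have h1 : ∀ j, (if j ∈ C then (μ j).1 j else 0) ≤ g.1 j := fun j => by
      split_ifs
      · exact hμmin j g hg
      · exact Nat.zero_le _
    have h2 : ∑ j, (if j ∈ C then (μ j).1 j else 0) = ∑ j ∈ C, (μ j).1 j := by
      simp [Finset.sum_ite_mem]
    refine fun j => ⟨h1 j, ?_⟩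
    have h3 := Finset.single_le_sum (f := fun j => g.1 j - (if j ∈ C then (μ j).1 j else 0))
      (fun _ _ => Nat.zero_le _) (Finset.mem_univ j)
    have h4 : ∑ j, (g.1 j - (if j ∈ C then (μ j).1 j else 0)) +
        ∑ j, (if j ∈ C then (μ j).1 j else 0) = m := by
      rw [← Finset.sum_add_distrib]
      exact (Finset.sum_congr rfl fun j _ => Nat.sub_add_cancel (h1 j)).trans (hG g)
    have h5 := h1 j
    omega
  refine ⟨x.1, hG x, fun i => ?_⟩
  by_cases hi : i ∈ C
  · obtain ⟨g, hg, hgi⟩ := hcol i hi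
    refine Or.inr ⟨g.1, hG g, hgi, fun j => ?_⟩
    have := hclose g hg j
    have := hclose x hx j
    omega
  · have := (hclose x hx i).2
    simp only [hi, if_false] at this
    left
    omega

theorem exists_le_of_mem_stdSimplex {x y : I → ℝ} (hx : x ∈ stdSimplex ℝ I)
    (hy : y ∈ stdSimplex ℝ I) : ∃ i, x i ≤ y i := by
  by_contra! h
  have := Finset.sum_lt_sum_of_nonempty (Finset.univ_nonempty (α := I)) fun i _ => h i
  rw [hx.2, hy.2] at this
  exact lt_irrefl _ this

/-- Approximate form of Brouwer's theorem. -/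
theorem exists_approx_fixed_point {g : (I → ℝ) → I → ℝ}
    (hmaps : Set.MapsTo g (stdSimplex ℝ I) (stdSimplex ℝ I)) {ε : ℝ} (hε : 0 < ε) :
    ∃ x ∈ stdSimplex ℝ I, ∀ i, x i ≤ ε ∨
      ∃ y ∈ stdSimplex ℝ I, y i ≤ g y i ∧ dist y x ≤ ε := by
  classical
  obtain ⟨m, hm⟩ := exists_nat_gt (Fintype.card I / ε)
  have hm0 : (0 : ℝ) < m := lt_of_le_of_lt (by positivity) hm
  have hmε : (Fintype.card I : ℝ) / m ≤ ε := by
    rw [div_lt_iff₀ hε] at hm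
    rw [div_le_iff₀ hm0]
    linarith
  let q : (I → ℕ) → I → ℝ := fun y i => y i / m
  have hq : ∀ y : I → ℕ, ∑ i, y i = m → q y ∈ stdSimplex ℝ I := fun y hy => by
    refine ⟨fun i => by positivity, ?_⟩
    simp only [q]
    rw [← Finset.sum_div, div_eq_one_iff_eq hm0.ne']
    exact_mod_cast hy
  -- Colour a grid point by a coordinate that `g` does not decrease; one exists because both points
  -- have coordinate sum 1.
  let c : (I → ℕ) → I := fun y =>
    if h : ∃ i, q y i ≤ g (q y) i then h.choose else Classical.arbitrary I
  have hc : ∀ y : I → ℕ, ∑ i, y i = m → q y (c y) ≤ g (q y) (c y) := fun y hy => by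
    have h : ∃ i, q y i ≤ g (q y) i := exists_le_of_mem_stdSimplex (hq y hy) (hmaps (hq y hy))
    simp only [c, dif_pos h]
    exact h.choose_spec
  obtain ⟨x, hx, h⟩ := exists_grid_point_near_colors m c
  refine ⟨q x, hq x hx, fun i => ?_⟩
  rcases h i with h | ⟨y, hy, hyi, hyx⟩
  · left
    refine le_trans ?_ hmε
    simp only [q]
    gcongr
  · refine Or.inr ⟨q y, hq y hy, hyi ▸ hc y hy, (dist_pi_le_iff hε.le).2 fun j => ?_⟩
    refine le_trans ?_ hmε
    obtain ⟨h1, h2⟩ := hyx j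
    have h1' : (y j : ℝ) ≤ x j + Fintype.card I := by exact_mod_cast h1
    have h2' : (x j : ℝ) ≤ y j + Fintype.card I := by exact_mod_cast h2
    simp only [q, Real.dist_eq]
    rw [← sub_div, abs_div, abs_of_pos hm0]
    gcongr
    rw [abs_le]
    constructor <;> linarith

/-- **Brouwer's fixed point theorem** on the standard simplex. -/
theorem exists_fixed_point_stdSimplex {g : (I → ℝ) → I → ℝ}
    (hmaps : Set.MapsTo g (stdSimplex ℝ I) (stdSimplex ℝ I))
    (hg : ContinuousOn g (stdSimplex ℝ I)) : ∃ x ∈ stdSimplex ℝ I, g x = x := by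
  choose X hX hXi using fun k : ℕ => exists_approx_fixed_point hmaps (Nat.one_div_pos_of_nat
    (α := ℝ) (n := k))
  obtain ⟨x, hx, φ, hφ, hlim⟩ := (isCompact_stdSimplex ℝ I).tendsto_subseq hX
  have hε : Filter.Tendsto (fun k => 1 / ((φ k : ℝ) + 1)) Filter.atTop (nhds 0) :=
    tendsto_one_div_add_atTop_nhds_zero_nat.comp hφ.tendsto_atTop
  -- This inequality suffices, since both sides sum to 1.
  have key : ∀ i, x i ≤ g x i := by
    intro i
    by_contra! hi
    have hpos : 0 < x i := lt_of_le_of_lt ((hmaps hx).1 i) hi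
    have hgi : ContinuousWithinAt (fun y => g y i) (stdSimplex ℝ I) x :=
      (continuous_apply i).continuousAt.comp_continuousWithinAt (hg x hx)
    have hev : ∀ᶠ y in nhdsWithin x (stdSimplex ℝ I), g y i < y i :=
      hgi.eventually_lt (continuous_apply i).continuousWithinAt hi
    obtain ⟨δ, hδ, hball⟩ := Metric.mem_nhdsWithin_iff.1 hev
    have h1 : ∀ᶠ k in Filter.atTop, dist (X (φ k)) x < min (δ / 2) (x i / 2) :=
      Metric.tendsto_nhds.1 hlim _ (by positivity)
    have h2 : ∀ᶠ k in Filter.atTop, 1 / ((φ k : ℝ) + 1) < min (δ / 2) (x i / 2) :=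
      hε.eventually_lt_const (by positivity)
    obtain ⟨k, hk1, hk2⟩ := (h1.and h2).exists
    rw [lt_min_iff] at hk1 hk2
    rcases hXi (φ k) i with h | ⟨y, hy, hyi, hyx⟩
    · have := (dist_le_pi_dist (X (φ k)) x i).trans_lt hk1.2
      rw [Real.dist_eq, abs_lt] at this
      linarith
    · have : dist y x < δ := by
        linarith [dist_triangle y (X (φ k)) x]
      exact absurd (hball ⟨this, hy⟩ : g y i < y i) (not_lt.2 hyi)
  refine ⟨x, hx, ?_⟩
  have := (Finset.sum_eq_sum_iff_of_le fun i _ => key i).1 (hx.2.trans (hmaps hx).2.symm)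
  exact funext fun i => (this i (Finset.mem_univ i)).symm

end Brouwer

/-! ### Consequences of strict concavity and monotonicity. -/

section Utility

variable {K : ℕ} {u : (Fin K → ℝ) → EReal}

theorem IsUtility.coe_toReal (hu : IsUtility u) {x : Fin K → ℝ} (hx : 0 ≤ x) (h : ⊥ < u x) :
    ((u x).toReal : EReal) = u x :=
  EReal.coe_toReal (hu.lt_top x hx).ne h.ne'

theorem IsUtility.toReal_le_toReal (hu : IsUtility u) {x y : Fin K → ℝ} (hy : 0 ≤ y)
    (h : ⊥ < u x) (hxy : u x ≤ u y) : (u x).toReal ≤ (u y).toReal :=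
  EReal.toReal_le_toReal hxy h.ne' (hu.lt_top y hy).ne

theorem IsUtility.strictConcave_toReal (hu : IsUtility u) {x y : Fin K → ℝ} (hx : 0 ≤ x)
    (hy : 0 ≤ y) (hux : ⊥ < u x) (huy : ⊥ < u y) (hxy : x ≠ y) {a b : ℝ} (ha : 0 < a)
    (hb : 0 < b) (hab : a + b = 1) :
    ⊥ < u (a • x + b • y) ∧
      a * (u x).toReal + b * (u y).toReal < (u (a • x + b • y)).toReal := by
  have h := hu.strictlyConcave x y hx hy hux huy hxy a b ha hb hab
  have hz : 0 ≤ a • x + b • y := add_nonneg (smul_nonneg ha.le hx) (smul_nonneg hb.le hy)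
  have hbot : ⊥ < u (a • x + b • y) := bot_le.trans_lt h
  refine ⟨hbot, ?_⟩
  rw [← hu.coe_toReal hx hux, ← hu.coe_toReal hy huy, ← hu.coe_toReal hz hbot] at h
  exact_mod_cast h

theorem IsUtility.lt_combination (hu : IsUtility u) {x y : Fin K → ℝ} (hx : 0 ≤ x) (hy : 0 ≤ y)
    (hux : ⊥ < u x) (hxy : x ≠ y) (hle : u x ≤ u y) {a b : ℝ} (ha : 0 < a) (hb : 0 < b)
    (hab : a + b = 1) : u x < u (a • x + b • y) := by
  obtain ⟨h1, h2⟩ := hu.strictConcave_toReal hx hy hux (hux.trans_le hle) hxy ha hb hab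
  have hz : 0 ≤ a • x + b • y := add_nonneg (smul_nonneg ha.le hx) (smul_nonneg hb.le hy)
  have h3 := hu.toReal_le_toReal hy hux hle
  rw [← hu.coe_toReal hx hux, ← hu.coe_toReal hz h1, EReal.coe_lt_coe_iff]
  have h4 := mul_le_mul_of_nonneg_left h3 hb.le
  have h5 : a * (u x).toReal + b * (u x).toReal = (u x).toReal := by rw [← add_mul, hab, one_mul]
  linarith

theorem IsUtility.lt_add (hu : IsUtility u) {x v : Fin K → ℝ} (hx : 0 ≤ x) (hux : ⊥ < u x)
    (hv : 0 < v) : u x < u (x + v) :=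
  hu.strictlyIncreasing x _ hx hux (lt_add_of_pos_right x hv)

theorem single_pos_of_pos {k : Fin K} {t : ℝ} (ht : 0 < t) : (0 : Fin K → ℝ) < Pi.single k t :=
  Pi.single_pos.2 ht

end Utility

/-! ### Demand truncated to a box. -/

section Demand

variable {K : ℕ} {u : (Fin K → ℝ) → EReal}

/-- The budget set at prices `p` and endowment `e`, truncated to the box below `c`. -/
def truncatedBudget (c e p : Fin K → ℝ) : Set (Fin K → ℝ) :=
  {y | y ∈ Set.Icc 0 c ∧ p ⬝ᵥ y ≤ p ⬝ᵥ e}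

/-- `d` maximizes utility over the truncated budget set. -/
def IsDemand (u : (Fin K → ℝ) → EReal) (c e p d : Fin K → ℝ) : Prop :=
  d ∈ truncatedBudget c e p ∧ ∀ y ∈ truncatedBudget c e p, u y ≤ u d

theorem exists_isDemand (hu : IsUtility u) {c e : Fin K → ℝ} (he : e ∈ Set.Icc 0 c)
    (p : Fin K → ℝ) : ∃ d, IsDemand u c e p d := by
  have hc : IsCompact (truncatedBudget c e p) :=
    isCompact_Icc.inter_right (isClosed_le (continuous_const.dotProduct continuous_id)
      continuous_const)
  obtain ⟨d, hd, hmax⟩ := hc.exists_isMaxOn ⟨e, he, le_rfl⟩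
    (hu.continuousOn.mono fun y hy => hy.1.1)
  exact ⟨d, hd, fun y hy => hmax hy⟩

theorem IsDemand.bot_lt (hu : IsUtility u) {c e p d : Fin K → ℝ} (he : ∀ k, 0 < e k)
    (hec : e ≤ c) (hd : IsDemand u c e p d) : ⊥ < u d :=
  (hu.finite_of_pos e he).trans_le (hd.2 e ⟨⟨fun k => (he k).le, hec⟩, le_rfl⟩)

theorem IsDemand.unique (hu : IsUtility u) {c e p d d' : Fin K → ℝ} (he : ∀ k, 0 < e k)
    (hec : e ≤ c) (hd : IsDemand u c e p d) (hd' : IsDemand u c e p d') : d = d' := by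
  by_contra hne
  have h := hu.lt_combination hd.1.1.1 hd'.1.1.1 (hd.bot_lt hu he hec) hne (hd'.2 d hd.1)
    (a := 1 / 2) (b := 1 / 2) (by norm_num) (by norm_num) (by norm_num)
  refine absurd (hd.2 _ ⟨?_, ?_⟩) (not_le.2 h)
  · exact convex_Icc (𝕜 := ℝ) (0 : Fin K → ℝ) c hd.1.1 hd'.1.1 (by norm_num) (by norm_num)
      (by norm_num)
  · have h1 := hd.1.2
    have h2 := hd'.1.2
    simp only [dotProduct_add, dotProduct_smul, smul_eq_mul]
    linarith

theorem dotProduct_pos_of_mem_stdSimplex {p e : Fin K → ℝ} (hp : p ∈ stdSimplex ℝ (Fin K))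
    (he : ∀ k, 0 < e k) : 0 < p ⬝ᵥ e := by
  have h0 : ∀ k ∈ Finset.univ, 0 ≤ p k * e k := fun k _ => mul_nonneg (hp.1 k) (he k).le
  refine lt_of_le_of_ne (Finset.sum_nonneg h0) fun h => ?_
  have h1 := (Finset.sum_eq_zero_iff_of_nonneg h0).1 h.symm
  have h2 : ∀ k, p k = 0 := fun k =>
    (mul_eq_zero.1 (h1 k (Finset.mem_univ k))).resolve_right (he k).ne'
  have h3 := hp.2
  simp [h2] at h3

/-- Optimality against the bundles costing strictly less than the income suffices, and is a closed
condition in `(p, d)`. -/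
theorem isDemand_iff (hu : IsUtility u) {c e p d : Fin K → ℝ} (hpe : 0 < p ⬝ᵥ e) :
    IsDemand u c e p d ↔ d ∈ Set.Icc 0 c ∧ p ⬝ᵥ d ≤ p ⬝ᵥ e ∧
      ∀ y ∈ Set.Icc 0 c, p ⬝ᵥ e ≤ p ⬝ᵥ y ∨ u y ≤ u d := by
  constructor
  · rintro ⟨⟨h1, h2⟩, h3⟩
    exact ⟨h1, h2, fun y hy => (le_or_gt _ _).imp_right fun h => h3 y ⟨hy, h.le⟩⟩
  · rintro ⟨h1, h2, h3⟩
    refine ⟨⟨h1, h2⟩, fun y hy => ?_⟩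
    -- An affordable `y` is a limit of the bundles `t • y` with `t < 1`, which cost strictly less
    -- than the positive income.
    have hlim : Filter.Tendsto (fun t : ℝ => u (t • y)) (nhdsWithin 1 (Set.Ioo 0 1))
        (nhds (u y)) := by
      refine Filter.Tendsto.comp (hu.continuousOn y hy.1.1) (tendsto_nhdsWithin_iff.2 ⟨?_, ?_⟩)
      · have : Continuous fun t : ℝ => t • y := by fun_prop
        exact (this.tendsto' 1 y (one_smul ℝ y)).mono_left nhdsWithin_le_nhds
      · filter_upwards [self_mem_nhdsWithin] with t ht
        exact smul_nonneg ht.1.le hy.1.1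
    have : (nhdsWithin (1 : ℝ) (Set.Ioo 0 1)).NeBot := by
      rw [← mem_closure_iff_nhdsWithin_neBot, closure_Ioo (by norm_num)]
      simp
    refine le_of_tendsto hlim ?_
    filter_upwards [self_mem_nhdsWithin] with t ht
    refine (h3 (t • y) ⟨smul_nonneg ht.1.le hy.1.1, fun k => ?_⟩).resolve_left (not_le.2 ?_)
    · have h4 : 0 ≤ y k := hy.1.1 k
      have h5 : y k ≤ c k := hy.1.2 k
      have := mul_le_of_le_one_left h4 ht.2.le
      simp only [Pi.smul_apply, smul_eq_mul]
      linarith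
    · rw [dotProduct_smul, smul_eq_mul]
      have := hy.2
      nlinarith [ht.1, ht.2]

/-- A closed-graph argument: by uniqueness of demand, the preimage of a closed `F` is the projection
of the closed set `S` along the compact box, and such projections are closed maps. -/
theorem continuousOn_demand (hu : IsUtility u) {c e : Fin K → ℝ} (he : ∀ k, 0 < e k)
    (hec : e ≤ c) {D : (Fin K → ℝ) → Fin K → ℝ} (hD : ∀ p, IsDemand u c e p (D p)) :
    ContinuousOn D (stdSimplex ℝ (Fin K)) := by
  rw [continuousOn_iff_continuous_domRestrict, continuous_iff_isClosed]
  intro F hF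
  let S : Set (stdSimplex ℝ (Fin K) × Set.Icc (0 : Fin K → ℝ) c) :=
    {q | q.2.1 ∈ F ∧ q.1.1 ⬝ᵥ q.2.1 ≤ q.1.1 ⬝ᵥ e ∧
      ∀ y ∈ Set.Icc 0 c, q.1.1 ⬝ᵥ e ≤ q.1.1 ⬝ᵥ y ∨ u y ≤ u q.2.1}
  have h1 : Continuous fun q : stdSimplex ℝ (Fin K) × Set.Icc (0 : Fin K → ℝ) c => q.1.1 :=
    continuous_subtype_val.comp continuous_fst
  have h2 : Continuous fun q : stdSimplex ℝ (Fin K) × Set.Icc (0 : Fin K → ℝ) c => q.2.1 :=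
    continuous_subtype_val.comp continuous_snd
  have h3 : Continuous fun q : stdSimplex ℝ (Fin K) × Set.Icc (0 : Fin K → ℝ) c => u q.2.1 :=
    hu.continuousOn.comp_continuous h2 fun q => q.2.2.1
  have h4 : IsClosed {q : stdSimplex ℝ (Fin K) × Set.Icc (0 : Fin K → ℝ) c |
      ∀ y ∈ Set.Icc 0 c, q.1.1 ⬝ᵥ e ≤ q.1.1 ⬝ᵥ y ∨ u y ≤ u q.2.1} := by
    simp only [Set.ofPred_forall]
    exact isClosed_iInter fun y => isClosed_iInter fun _ =>
      (isClosed_le (h1.dotProduct continuous_const) (h1.dotProduct continuous_const)).union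
        (isClosed_le continuous_const h3)
  have hS : IsClosed S := (hF.preimage h2).inter ((isClosed_le (h1.dotProduct h2)
      (h1.dotProduct continuous_const)).inter h4)
  convert isClosedMap_fst_of_compactSpace S hS using 1
  ext p
  have hpe := dotProduct_pos_of_mem_stdSimplex p.2 he
  simp only [Set.mem_preimage, Set.domRestrict_apply, Set.mem_image]
  constructor
  · intro h
    obtain ⟨h4, h5, h6⟩ := (isDemand_iff hu hpe).1 (hD p)
    exact ⟨(p, ⟨D p, h4⟩), ⟨h, h5, h6⟩, rfl⟩
  · rintro ⟨⟨p', d⟩, ⟨h4, h5, h6⟩, rfl⟩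
    have h7 := (hD p').unique hu he hec ((isDemand_iff hu hpe).2 ⟨d.2, h5, h6⟩)
    exact h7 ▸ h4

/-- If the box does not bind, demand is optimal in the whole budget set. -/
theorem IsDemand.optimal (hu : IsUtility u) {c e p d : Fin K → ℝ} (he : ∀ k, 0 < e k)
    (hec : e ≤ c) (hd : IsDemand u c e p d) (hdc : ∀ k, d k < c k) {y : Fin K → ℝ} (hy : 0 ≤ y)
    (hpy : p ⬝ᵥ y ≤ p ⬝ᵥ e) : u y ≤ u d := by
  by_contra! hlt
  -- A short step from `d` towards `y` stays in the box and, by concavity, would already improve on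
  -- `d`.
  have hev : ∀ᶠ t : ℝ in nhds 0, ∀ k, (1 - t) * d k + t * y k < c k := by
    refine Filter.eventually_all.2 fun k => ?_
    have : Continuous fun t : ℝ => (1 - t) * d k + t * y k := by fun_prop
    exact this.continuousAt.eventually_lt continuousAt_const (by simpa using hdc k)
  obtain ⟨t, ⟨htc, ht1⟩, ht0⟩ := (((hev.and (eventually_lt_nhds zero_lt_one)).filter_mono
    nhdsWithin_le_nhds).and (self_mem_nhdsWithin (s := Set.Ioi (0 : ℝ)))).exists
  have ht0 : 0 < t := ht0
  have h := hu.lt_combination hd.1.1.1 hy (hd.bot_lt hu he hec)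
    (fun h => hlt.ne (congrArg u h)) hlt.le (a := 1 - t) (b := t) (by linarith) ht0 (by ring)
  refine absurd (hd.2 ((1 - t) • d + t • y) ⟨⟨?_, fun k => (htc k).le⟩, ?_⟩) (not_le.2 h)
  · exact add_nonneg (smul_nonneg (by linarith) hd.1.1.1) (smul_nonneg ht0.le hy)
  · have h1 := hd.1.2
    simp only [dotProduct_add, dotProduct_smul, smul_eq_mul]
    nlinarith

end Demand

/-! ### Existence of a Walrasian equilibrium. -/

section Equilibrium

/-- **Gale–Nikaido–Debreu lemma**: a continuous excess demand function on the price simplex that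
satisfies the weak form of Walras' law is nonpositive at some price vector. -/
theorem exists_excess_demand_nonpos {I : Type*} [Fintype I] [Nonempty I]
    {z : (I → ℝ) → I → ℝ} (hz : ContinuousOn z (stdSimplex ℝ I))
    (hW : ∀ p ∈ stdSimplex ℝ I, p ⬝ᵥ z p ≤ 0) : ∃ p ∈ stdSimplex ℝ I, z p ≤ 0 := by
  have hS : ∀ p, 0 ≤ ∑ i, max (z p i) 0 := fun p => Finset.sum_nonneg fun i _ => le_max_right _ _
  have hzi : ∀ i, ContinuousOn (fun p => max (z p i) 0) (stdSimplex ℝ I) := fun i =>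
    ContinuousOn.sup ((continuous_apply i).comp_continuousOn hz) continuousOn_const
  -- The map raises the prices of goods in excess demand and renormalizes. At a fixed point the
  -- positive part of `z p` is proportional to `p`, so Walras' law bounds its pairing with `z p` by
  -- zero.
  obtain ⟨p, hp, hfix⟩ := exists_fixed_point_stdSimplex
    (g := fun p i => (p i + max (z p i) 0) / (1 + ∑ j, max (z p j) 0))
    (by
      intro p hp
      refine ⟨fun i => ?_, ?_⟩
      · have := hp.1 i
        have := hS p
        positivity
      · rw [← Finset.sum_div, Finset.sum_add_distrib, hp.2]
        exact div_self (by linarith [hS p]))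
    (continuousOn_pi.2 fun i => ((continuous_apply i).continuousOn.add (hzi i)).div
      (continuousOn_const.add (continuousOn_finsetSum _ fun j _ => hzi j))
      fun p _ => by linarith [hS p])
  refine ⟨p, hp, fun i => ?_⟩
  have h1 : ∀ i, max (z p i) 0 = p i * ∑ j, max (z p j) 0 := fun i => by
    have := congrFun hfix i
    rw [div_eq_iff (by linarith [hS p])] at this
    linarith
  have h2 : ∀ i ∈ Finset.univ, 0 ≤ max (z p i) 0 * z p i := fun i _ => by
    rcases le_total (z p i) 0 with h | h
    · simp [h]
    · exact mul_nonneg (le_max_right _ _) h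
  have h3 : ∑ i, max (z p i) 0 * z p i ≤ 0 := by
    have : ∑ i, max (z p i) 0 * z p i = (∑ j, max (z p j) 0) * (p ⬝ᵥ z p) := by
      rw [dotProduct, Finset.mul_sum]
      refine Finset.sum_congr rfl fun i _ => ?_
      rw [h1 i]
      ring
    rw [this]
    exact mul_nonpos_of_nonneg_of_nonpos (hS p) (hW p hp)
  have h4 := (Finset.sum_eq_zero_iff_of_nonneg h2).1 (le_antisymm h3 (Finset.sum_nonneg h2)) i
    (Finset.mem_univ i)
  by_contra! h
  have h : 0 < z p i := h
  rw [max_eq_left h.le] at h4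
  nlinarith

variable {N K : ℕ}

/-- Bundles worth no more than the unspent income cannot be added to an optimal bundle. -/
theorem IsUtility.lt_dotProduct_of_optimal {u : (Fin K → ℝ) → EReal} (hu : IsUtility u)
    {e p x : Fin K → ℝ} (hx : 0 ≤ x) (hux : ⊥ < u x)
    (hopt : ∀ y, 0 ≤ y → p ⬝ᵥ y ≤ p ⬝ᵥ e → u y ≤ u x) {v : Fin K → ℝ} (hv : 0 < v) :
    p ⬝ᵥ e < p ⬝ᵥ x + p ⬝ᵥ v := by
  by_contra! h
  rw [← dotProduct_add] at h
  exact absurd (hopt _ (add_nonneg hx hv.le) h) (not_le.2 (hu.lt_add hx hux hv))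

/-- One more unit of good `k` must cost more than the unspent income, which is nonnegative. -/
theorem IsUtility.price_pos_of_optimal {u : (Fin K → ℝ) → EReal} (hu : IsUtility u)
    {e p x : Fin K → ℝ} (hx : 0 ≤ x) (hux : ⊥ < u x) (hpx : p ⬝ᵥ x ≤ p ⬝ᵥ e)
    (hopt : ∀ y, 0 ≤ y → p ⬝ᵥ y ≤ p ⬝ᵥ e → u y ≤ u x) (k : Fin K) : 0 < p k := by
  have h1 := hu.lt_dotProduct_of_optimal hx hux hopt (single_pos_of_pos (k := k) one_pos)
  rw [dotProduct_single_one] at h1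
  linarith

theorem IsUtility.budget_eq_of_optimal {u : (Fin K → ℝ) → EReal} (hu : IsUtility u)
    {e p x : Fin K → ℝ} (hx : 0 ≤ x) (hux : ⊥ < u x) (hpx : p ⬝ᵥ x ≤ p ⬝ᵥ e)
    (hopt : ∀ y, 0 ≤ y → p ⬝ᵥ y ≤ p ⬝ᵥ e → u y ≤ u x) : p ⬝ᵥ x = p ⬝ᵥ e := by
  rcases isEmpty_or_nonempty (Fin K) with hK | ⟨⟨k⟩⟩
  · simp [dotProduct]
  have hpk := hu.price_pos_of_optimal hx hux hpx hopt k
  by_contra hne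
  have hgap : 0 < (p ⬝ᵥ e - p ⬝ᵥ x) / p k := div_pos (sub_pos.2 (lt_of_le_of_ne hpx hne)) hpk
  have h1 := hu.lt_dotProduct_of_optimal hx hux hopt (single_pos_of_pos (k := k) hgap)
  rw [dotProduct_single, mul_div_cancel₀ _ hpk.ne'] at h1
  linarith

theorem dotProduct_totalEndowment (p : Fin K → ℝ) (ω : Fin N → Fin K → ℝ) :
    p ⬝ᵥ totalEndowment ω = ∑ i, p ⬝ᵥ ω i := by
  rw [totalEndowment, dotProduct_sum]

/-- Existence of a Walrasian equilibrium. -/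
theorem exists_isWalrasianEquilibrium (hN : 0 < N)
    {u : Fin N → (Fin K → ℝ) → EReal} (hu : ∀ i, IsUtility (u i))
    {ω : Fin N → Fin K → ℝ} (hω : ∀ i k, 0 < ω i k) :
    ∃ x p, IsWalrasianEquilibrium u ω x p ∧ (∀ i, ⊥ < u i (x i)) ∧ ∀ k, 0 < p k := by
  -- With no goods the price simplex is empty, so this case is separate.
  rcases isEmpty_or_nonempty (Fin K) with hK | hK
  · refine ⟨ω, 0, ⟨le_rfl, fun i k => (hω i k).le, fun i => le_rfl, fun i y _ _ => ?_, rfl⟩,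
      fun i => (hu i).finite_of_pos _ (hω i), fun k => hK.elim k⟩
    rw [Subsingleton.elim y (ω i)]
  set w := totalEndowment ω with hw
  have hωw : ∀ i, ω i ≤ w := fun i =>
    Finset.single_le_sum (f := ω) (fun j _ k => (hω j k).le) (Finset.mem_univ i)
  -- The box is capped at `w + 1` so that it cannot bind on a bundle bounded by `w`.
  have hec : ∀ i, ω i ≤ w + 1 := fun i =>
    (hωw i).trans (le_add_of_nonneg_right zero_le_one)
  choose D hD using fun i =>
    fun p => exists_isDemand (hu i) ⟨fun k => (hω i k).le, hec i⟩ p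
  obtain ⟨p, hp, hz⟩ := exists_excess_demand_nonpos (z := fun p => ∑ i, D i p - w)
    ((continuousOn_finsetSum _ fun i _ =>
      continuousOn_demand (hu i) (hω i) (hec i) (hD i)).sub continuousOn_const)
    (fun p _ => by
      rw [dotProduct_sub, dotProduct_sum, dotProduct_totalEndowment, sub_nonpos]
      exact Finset.sum_le_sum fun i _ => (hD i p).1.2)
  have hsum : ∑ i, D i p ≤ w := sub_nonpos.1 hz
  have h0 : ∀ i, 0 ≤ D i p := fun i => (hD i p).1.1.1
  have hfin : ∀ i, ⊥ < u i (D i p) := fun i => (hD i p).bot_lt (hu i) (hω i) (hec i)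
  have hopt : ∀ i y, 0 ≤ y → p ⬝ᵥ y ≤ p ⬝ᵥ ω i → u i y ≤ u i (D i p) := fun i y hy hpy => by
    refine (hD i p).optimal (hu i) (hω i) (hec i) (fun k => ?_) hy hpy
    have h1 : D i p ≤ w := (Finset.single_le_sum (f := fun i => D i p) (fun j _ => h0 j)
      (Finset.mem_univ i)).trans hsum
    have h2 := h1 k
    simp only [Pi.add_apply, Pi.one_apply]
    linarith
  have hpos : ∀ k, 0 < p k :=
    (hu ⟨0, hN⟩).price_pos_of_optimal (h0 _) (hfin _) (hD _ p).1.2 (hopt _)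
  refine ⟨fun i => D i p, p, ⟨hp.1, h0, fun i => (hD i p).1.2, hopt, ?_⟩, hfin, hpos⟩
  -- Budgets are exhausted, so the excess supply is worth nothing; at positive prices it vanishes
  -- good by good.
  have hval : p ⬝ᵥ (w - ∑ i, D i p) = 0 := by
    rw [dotProduct_sub, dotProduct_totalEndowment, dotProduct_sum, sub_eq_zero]
    exact Finset.sum_congr rfl fun i _ =>
      ((hu i).budget_eq_of_optimal (h0 i) (hfin i) (hD i p).1.2 (hopt i)).symm
  have hzero := (Finset.sum_eq_zero_iff_of_nonneg
    fun k _ => mul_nonneg (hpos k).le (sub_nonneg.2 hsum k)).1 hval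
  refine le_antisymm hsum fun k => ?_
  have := (mul_eq_zero.1 (hzero k (Finset.mem_univ k))).resolve_left (hpos k).ne'
  simp only [Pi.sub_apply] at this
  linarith

end Equilibrium

/-! ### Supporting prices and the multiplier of income. -/

section Support

variable {K : ℕ} {u : (Fin K → ℝ) → EReal}

/-- `x` has finite utility and maximizes `u(y) - ⟨q|y⟩` over the orthant. -/
structure IsSupported (u : (Fin K → ℝ) → EReal) (q x : Fin K → ℝ) : Prop where
  nonneg : 0 ≤ x
  bot_lt : ⊥ < u x
  le : ∀ y, 0 ≤ y → ⊥ < u y → (u y).toReal - q ⬝ᵥ y ≤ (u x).toReal - q ⬝ᵥ x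

theorem IsSupported.fenchelDual_eq (hu : IsUtility u) {q x : Fin K → ℝ} (h : IsSupported u q x) :
    fenchelDual u q = (((u x).toReal - q ⬝ᵥ x : ℝ) : EReal) := by
  refine le_antisymm (iSup₂_le fun y hy => ?_) ?_
  · rcases eq_bot_or_bot_lt (u y) with hb | hb
    · rw [hb, EReal.bot_sub]
      exact bot_le
    · rw [← hu.coe_toReal hy hb, ← EReal.coe_sub, EReal.coe_le_coe_iff]
      exact h.le y hy hb
  · rw [EReal.coe_sub, hu.coe_toReal h.nonneg h.bot_lt]
    exact le_iSup₂ (f := fun (x : Fin K → ℝ) (_ : x ∈ {x : Fin K → ℝ | 0 ≤ x}) =>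
      u x - ((q ⬝ᵥ x : ℝ) : EReal)) x h.nonneg

/-- If two distinct bundles attained the maximum, strict concavity would make their midpoint better
still. -/
theorem IsSupported.eq_of_le (hu : IsUtility u) {q x y : Fin K → ℝ} (h : IsSupported u q x)
    (hy : 0 ≤ y) (huy : ⊥ < u y)
    (hle : (u x).toReal - q ⬝ᵥ x ≤ (u y).toReal - q ⬝ᵥ y) : x = y := by
  by_contra hne
  obtain ⟨h1, h2⟩ := hu.strictConcave_toReal h.nonneg hy h.bot_lt huy hne (a := 1 / 2)
    (b := 1 / 2) (by norm_num) (by norm_num) (by norm_num)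
  have h3 := h.le _ (add_nonneg (smul_nonneg (by norm_num) h.nonneg)
    (smul_nonneg (by norm_num) hy)) h1
  simp only [dotProduct_add, dotProduct_smul, smul_eq_mul] at h3
  linarith

theorem IsSupported.price_pos (hu : IsUtility u) {q x : Fin K → ℝ} (h : IsSupported u q x)
    (k : Fin K) : 0 < q k := by
  have hv := single_pos_of_pos (k := k) one_pos
  have h1 := hu.lt_add h.nonneg h.bot_lt hv
  have hz : 0 ≤ x + Pi.single k 1 := add_nonneg h.nonneg hv.le
  have h2 := h.le _ hz (bot_le.trans_lt h1)
  rw [← hu.coe_toReal h.nonneg h.bot_lt, ← hu.coe_toReal hz (bot_le.trans_lt h1),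
    EReal.coe_lt_coe_iff] at h1
  rw [dotProduct_add, dotProduct_single_one] at h2
  linarith

/-- First-order condition for a good consumed in a positive amount. -/
theorem IsSupported.price_eq (hu : IsUtility u) {q x : Fin K → ℝ} (h : IsSupported u q x)
    {k : Fin K} (hk : 0 < x k) :
    q k = deriv (fun t : ℝ => (u (Function.update x k t)).toReal) (x k) := by
  have hdiff := hu.differentiable x h.nonneg h.bot_lt k hk
  have hcont : Filter.Tendsto (fun t : ℝ => u (Function.update x k t))
      (nhdsWithin (x k) (Set.Ici 0)) (nhds (u x)) := by
    refine Filter.Tendsto.comp (hu.continuousOn x h.nonneg) (tendsto_nhdsWithin_iff.2 ⟨?_, ?_⟩)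
    · have : Continuous fun t : ℝ => Function.update x k t :=
        continuous_const.update k continuous_id
      exact (this.tendsto' (x k) x (Function.update_eq_self k x)).mono_left nhdsWithin_le_nhds
    · filter_upwards [self_mem_nhdsWithin] with t ht
      exact le_update_iff.2 ⟨ht, fun j _ => h.nonneg j⟩
  -- As `x k > 0`, the amount can vary in both directions, which gives an equation rather than an
  -- inequality.
  have hnhds : nhdsWithin (x k) (Set.Ici 0) = nhds (x k) :=
    nhdsWithin_eq_nhds.2 (Ici_mem_nhds hk)
  rw [hnhds] at hcont
  have hmax : IsLocalMax (fun t : ℝ => (u (Function.update x k t)).toReal - q k * t) (x k) := by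
    filter_upwards [hcont.eventually_const_lt h.bot_lt, lt_mem_nhds hk] with t ht ht0
    have h1 := h.le _ (le_update_iff.2 ⟨ht0.le, fun j _ => h.nonneg j⟩) ht
    have h2 : q ⬝ᵥ Function.update x k t = q ⬝ᵥ x + q k * (t - x k) := by
      have : Function.update x k t = x + Pi.single k (t - x k) := by
        ext j
        by_cases hj : j = k
        · subst hj
          simp
        · simp [hj]
      rw [this, dotProduct_add, dotProduct_single]
    rw [h2] at h1
    simp only [Function.update_eq_self]
    linarith
  have h3 := hmax.deriv_eq_zero
  rw [deriv_fun_sub hdiff (by fun_prop), deriv_const_mul_field, deriv_id'', mul_one] at h3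
  linarith

/-- Lagrange multiplier (marginal utility of income) of an optimal bundle. -/
theorem IsUtility.exists_multiplier (hu : IsUtility u) {e p x : Fin K → ℝ} (he : ∀ k, 0 < e k)
    (hp : ∀ k, 0 < p k) (hx : 0 ≤ x) (hux : ⊥ < u x) (hpx : p ⬝ᵥ x ≤ p ⬝ᵥ e)
    (hopt : ∀ y, 0 ≤ y → p ⬝ᵥ y ≤ p ⬝ᵥ e → u y ≤ u x) :
    ∃ l : ℝ, 0 < l ∧ IsSupported u (l • p) x := by
  rcases isEmpty_or_nonempty (Fin K) with hK | ⟨⟨k⟩⟩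
  · refine ⟨1, one_pos, hx, hux, fun y _ _ => ?_⟩
    rw [Subsingleton.elim y x]
  have hpx := hu.budget_eq_of_optimal hx hux hpx hopt
  have hm : 0 < p ⬝ᵥ e := Finset.sum_pos (fun k _ => mul_pos (hp k) (he k)) ⟨k, Finset.mem_univ k⟩
  set m := p ⬝ᵥ e with hmdef
  -- Mix a cheaper `y` and a dearer `z` with the weights for which the cost is exactly `m`. The
  -- mixture is no better than `x`, so utility per unit of money gained above `m` is at most that
  -- lost below `m`.
  have cross : ∀ y z, 0 ≤ y → 0 ≤ z → ⊥ < u y → ⊥ < u z → p ⬝ᵥ y < m → m < p ⬝ᵥ z →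
      ((u z).toReal - (u x).toReal) / (p ⬝ᵥ z - m) ≤
        ((u x).toReal - (u y).toReal) / (m - p ⬝ᵥ y) := by
    intro y z hy hz huy huz hym hzm
    have hA : 0 < m - p ⬝ᵥ y := sub_pos.2 hym
    have hB : 0 < p ⬝ᵥ z - m := sub_pos.2 hzm
    set A := m - p ⬝ᵥ y with hAdef
    set B := p ⬝ᵥ z - m with hBdef
    have hAB : 0 < A + B := add_pos hA hB
    have hab : B / (A + B) + A / (A + B) = 1 := by
      rw [← add_div, add_comm B A, div_self hAB.ne']
    obtain ⟨h1, h2⟩ := hu.strictConcave_toReal hy hz huy huz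
      (fun h => by rw [h] at hym; linarith) (div_pos hB hAB) (div_pos hA hAB) hab
    have h3 : 0 ≤ (B / (A + B)) • y + (A / (A + B)) • z :=
      add_nonneg (smul_nonneg (div_pos hB hAB).le hy) (smul_nonneg (div_pos hA hAB).le hz)
    have h4 := hu.toReal_le_toReal hx h1 (hopt _ h3 (by
      rw [dotProduct_add, dotProduct_smul, dotProduct_smul, smul_eq_mul, smul_eq_mul,
        div_mul_eq_mul_div, div_mul_eq_mul_div, ← add_div, div_le_iff₀ hAB]
      exact le_of_eq (by rw [hAdef, hBdef]; ring)))
    have h5 := h2.le.trans h4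
    rw [div_mul_eq_mul_div, div_mul_eq_mul_div, ← add_div, div_le_iff₀ hAB] at h5
    rw [div_le_div_iff₀ hB hA]
    linarith
  -- The multiplier is the supremum of the slopes above income `m`; by `cross` it separates them
  -- from the slopes below.
  set S : Set ℝ := {s | ∃ z, 0 ≤ z ∧ ⊥ < u z ∧ m < p ⬝ᵥ z ∧
    s = ((u z).toReal - (u x).toReal) / (p ⬝ᵥ z - m)} with hS
  have hbdd : BddAbove S := by
    have hhalf : ∀ k, 0 < ((1 / 2 : ℝ) • e) k := fun k => mul_pos (by norm_num) (he k)
    -- Half the endowment costs less than `m` and has finite utility, so its slope is an upper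
    -- bound.
    refine ⟨((u x).toReal - (u ((1 / 2 : ℝ) • e)).toReal) / (m - p ⬝ᵥ ((1 / 2 : ℝ) • e)), ?_⟩
    rintro _ ⟨z, h1, h2, h3, rfl⟩
    refine cross _ z (fun k => (hhalf k).le) h1 (hu.finite_of_pos _ hhalf) h2 ?_ h3
    rw [dotProduct_smul, smul_eq_mul]
    linarith
  have hv := single_pos_of_pos (k := k) one_pos
  have hlt := hu.lt_add hx hux hv
  have hz0 : 0 ≤ x + Pi.single k 1 := add_nonneg hx hv.le
  have hzb : ⊥ < u (x + Pi.single k 1) := bot_le.trans_lt hlt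
  have hzm : m < p ⬝ᵥ (x + Pi.single k 1) := by
    rw [dotProduct_add, dotProduct_single_one]
    linarith [hp k]
  have hmem : ((u (x + Pi.single k 1)).toReal - (u x).toReal) / (p ⬝ᵥ (x + Pi.single k 1) - m) ∈ S :=
    ⟨_, hz0, hzb, hzm, rfl⟩
  refine ⟨sSup S, (div_pos (sub_pos.2 ?_) (sub_pos.2 hzm)).trans_le (le_csSup hbdd hmem),
    hx, hux, fun y hy huy => ?_⟩
  · rwa [← hu.coe_toReal hx hux, ← hu.coe_toReal hz0 hzb, EReal.coe_lt_coe_iff] at hlt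
  rw [smul_dotProduct, smul_dotProduct, smul_eq_mul, smul_eq_mul, hpx]
  rcases lt_trichotomy (p ⬝ᵥ y) m with h | h | h
  · have h1 : sSup S ≤ ((u x).toReal - (u y).toReal) / (m - p ⬝ᵥ y) := by
      refine csSup_le ⟨_, hmem⟩ ?_
      rintro _ ⟨z, h1, h2, h3, rfl⟩
      exact cross y z hy h1 huy h2 h h3
    rw [le_div_iff₀ (sub_pos.2 h)] at h1
    linarith
  · have := hu.toReal_le_toReal hx huy (hopt y hy h.le)
    rw [h]
    linarith
  · have h1 := le_csSup hbdd ⟨y, hy, huy, h, rfl⟩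
    rw [div_le_iff₀ (sub_pos.2 h)] at h1
    linarith

end Support

/-! ### Roots of the potential and their uniqueness. -/

section Potential

variable {N K : ℕ} {u : Fin N → (Fin K → ℝ) → EReal} {α : Fin N → ℝ}

theorem coe_ereal_sum {ι : Type*} (s : Finset ι) (f : ι → ℝ) :
    ((∑ i ∈ s, f i : ℝ) : EReal) = ∑ i ∈ s, (f i : EReal) :=
  map_sum (⟨⟨Real.toEReal, EReal.coe_zero⟩, EReal.coe_add⟩ : ℝ →+ EReal) f s

theorem weightedUtility_eq_coe (hu : ∀ i, IsUtility (u i)) {x : Fin N → Fin K → ℝ}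
    (hx : ∀ i, 0 ≤ x i) (hux : ∀ i, ⊥ < u i (x i)) :
    weightedUtility u α x = ((∑ i, α i * (u i (x i)).toReal : ℝ) : EReal) := by
  rw [weightedUtility, coe_ereal_sum]
  refine Finset.sum_congr rfl fun i _ => ?_
  rw [EReal.coe_mul, (hu i).coe_toReal (hx i) (hux i)]

theorem dualWelfare_eq_coe {p w : Fin K → ℝ} {F : Fin N → ℝ}
    (hF : ∀ i, fenchelDual (u i) ((α i)⁻¹ • p) = F i) :
    dualWelfare u α p w = ((p ⬝ᵥ w + ∑ i, α i * F i : ℝ) : EReal) := by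
  rw [dualWelfare, EReal.coe_add, coe_ereal_sum]
  simp only [hF, EReal.coe_mul]

theorem inv_smul_dotProduct_mul {a : ℝ} (ha : 0 < a) (p y : Fin K → ℝ) :
    a * ((a⁻¹ • p) ⬝ᵥ y) = p ⬝ᵥ y := by
  rw [smul_dotProduct, smul_eq_mul, mul_inv_cancel_left₀ ha.ne']

/-- A supported allocation that exhausts the value of the endowment is a root of the potential. -/
theorem isPotentialRoot_of_isSupported (hu : ∀ i, IsUtility (u i)) (hα : ∀ i, 0 < α i)
    {x : Fin N → Fin K → ℝ} {p w : Fin K → ℝ} (hp : 0 ≤ p) (hw : ∑ i, x i = w)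
    (h : ∀ i, IsSupported (u i) ((α i)⁻¹ • p) (x i)) : IsPotentialRoot u α w x p := by
  refine ⟨⟨fun i => (h i).nonneg, fun k => by rw [← hw, Finset.sum_apply]⟩, hp, ?_⟩
  rw [potential, weightedUtility_eq_coe hu (fun i => (h i).nonneg) fun i => (h i).bot_lt,
    dualWelfare_eq_coe fun i => (h i).fenchelDual_eq (hu i), ← EReal.coe_sub, EReal.coe_eq_zero,
    ← hw, dotProduct_sum]
  simp only [mul_sub, inv_smul_dotProduct_mul (hα _), Finset.sum_sub_distrib]
  ring

theorem sum_eq_bot_of_eq_bot {ι : Type*} {s : Finset ι} {f : ι → EReal} {i : ι} (hi : i ∈ s)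
    (h : f i = ⊥) : ∑ j ∈ s, f j = ⊥ := by
  classical
  rw [← Finset.add_sum_erase s f hi, h, EReal.bot_add]

theorem bot_lt_sum {ι : Type*} {s : Finset ι} {f : ι → EReal} (h : ∀ i ∈ s, ⊥ < f i) :
    ⊥ < ∑ j ∈ s, f j :=
  Finset.sum_induction f (⊥ < ·) (fun _ _ ha hb => EReal.bot_lt_add_iff.2 ⟨ha, hb⟩)
    (EReal.bot_lt_coe 0) h

theorem sum_eq_top_of_eq_top {ι : Type*} {s : Finset ι} {f : ι → EReal} (h : ∀ i ∈ s, ⊥ < f i)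
    {i : ι} (hi : i ∈ s) (hi' : f i = ⊤) : ∑ j ∈ s, f j = ⊤ := by
  classical
  rw [← Finset.add_sum_erase s f hi, hi']
  exact EReal.top_add_of_ne_bot (bot_lt_sum fun j hj => h j (Finset.mem_of_mem_erase hj)).ne'

theorem bot_lt_fenchelDual {v : (Fin K → ℝ) → EReal} (hv : IsUtility v) (q : Fin K → ℝ) :
    ⊥ < fenchelDual v q := by
  have h1 : ⊥ < v 1 := hv.finite_of_pos 1 fun _ => one_pos
  have h0 : (0 : Fin K → ℝ) ≤ 1 := zero_le_one
  refine lt_of_lt_of_le ?_ (le_iSup₂ (f := fun (x : Fin K → ℝ)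
    (_ : x ∈ {x : Fin K → ℝ | 0 ≤ x}) => v x - ((q ⬝ᵥ x : ℝ) : EReal)) 1 h0)
  rw [← hv.coe_toReal h0 h1, ← EReal.coe_sub]
  exact EReal.bot_lt_coe _

/-- At a root of the potential every bundle is supported by the prices, and the allocation
exhausts the value of the endowment. -/
theorem IsPotentialRoot.isSupported (hu : ∀ i, IsUtility (u i)) (hα : ∀ i, 0 < α i)
    {x : Fin N → Fin K → ℝ} {p w : Fin K → ℝ} (h : IsPotentialRoot u α w x p) :
    (∀ i, IsSupported (u i) ((α i)⁻¹ • p) (x i)) ∧ ∑ i, p ⬝ᵥ x i = p ⬝ᵥ w := by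
  obtain ⟨⟨hx, hxw⟩, hp, h0⟩ := h
  -- In `EReal` subtraction a minuend `⊥` or a subtrahend `⊤` gives `⊥`, so a root forces all the
  -- utilities and duals to be finite.
  have hux : ∀ i, ⊥ < u i (x i) := by
    intro i
    by_contra hb
    rw [not_bot_lt_iff] at hb
    have : weightedUtility u α x = ⊥ := sum_eq_bot_of_eq_bot (Finset.mem_univ i) (by
      rw [hb, EReal.coe_mul_bot_of_pos (hα i)])
    rw [potential, this, EReal.bot_sub] at h0
    exact EReal.bot_ne_zero h0
  have hV : ∀ i, fenchelDual (u i) ((α i)⁻¹ • p) ≠ ⊤ := by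
    intro i ht
    have hsum : ∑ i, (α i : EReal) * fenchelDual (u i) ((α i)⁻¹ • p) = ⊤ :=
      sum_eq_top_of_eq_top (fun j _ => by
        have h1 := bot_lt_fenchelDual (hu j) ((α j)⁻¹ • p)
        rcases eq_or_ne (fenchelDual (u j) ((α j)⁻¹ • p)) ⊤ with h2 | h2
        · rw [h2, EReal.coe_mul_top_of_pos (hα j)]
          exact bot_lt_top
        · rw [← EReal.coe_toReal h2 h1.ne', ← EReal.coe_mul]
          exact EReal.bot_lt_coe _) (Finset.mem_univ i) (by
        rw [ht, EReal.coe_mul_top_of_pos (hα i)])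
    rw [potential, dualWelfare, hsum, EReal.coe_add_top, EReal.sub_top] at h0
    exact EReal.bot_ne_zero h0
  set F : Fin N → ℝ := fun i => (fenchelDual (u i) ((α i)⁻¹ • p)).toReal with hFdef
  have hF : ∀ i, fenchelDual (u i) ((α i)⁻¹ • p) = F i := fun i =>
    (EReal.coe_toReal (hV i) (bot_lt_fenchelDual (hu i) _).ne').symm
  rw [potential, weightedUtility_eq_coe hu hx hux, dualWelfare_eq_coe hF, ← EReal.coe_sub,
    EReal.coe_eq_zero] at h0
  have hle : ∀ i y, 0 ≤ y → ⊥ < u i y → (u i y).toReal - ((α i)⁻¹ • p) ⬝ᵥ y ≤ F i := by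
    intro i y hy huy
    rw [← EReal.coe_le_coe_iff, ← hF i, EReal.coe_sub, (hu i).coe_toReal hy huy]
    exact le_iSup₂ (f := fun (x : Fin K → ℝ) (_ : x ∈ {x : Fin K → ℝ | 0 ≤ x}) =>
      u i x - ((((α i)⁻¹ • p) ⬝ᵥ x : ℝ) : EReal)) y hy
  -- Weighted Fenchel–Young inequality. Summed, it squeezes the value of the allocation between `p
  -- ⬝ᵥ w` and itself, so each term is an equality.
  have hterm : ∀ i ∈ Finset.univ, α i * (u i (x i)).toReal - α i * F i ≤ p ⬝ᵥ x i := by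
    intro i _
    have h1 := mul_le_mul_of_nonneg_left (hle i (x i) (hx i) (hux i)) (hα i).le
    rw [mul_sub, inv_smul_dotProduct_mul (hα i)] at h1
    linarith
  have hval : ∑ i, p ⬝ᵥ x i ≤ p ⬝ᵥ w := by
    rw [← dotProduct_sum]
    refine Finset.sum_le_sum fun k _ => mul_le_mul_of_nonneg_left ?_ (hp k)
    rw [Finset.sum_apply]
    exact hxw k
  have hdiff : ∑ i, (α i * (u i (x i)).toReal - α i * F i) = p ⬝ᵥ w := by
    rw [Finset.sum_sub_distrib]
    linarith
  have heq : ∑ i, p ⬝ᵥ x i = p ⬝ᵥ w :=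
    le_antisymm hval (hdiff ▸ Finset.sum_le_sum hterm)
  refine ⟨fun i => ⟨hx i, hux i, fun y hy huy => (hle i y hy huy).trans (le_of_eq ?_)⟩, heq⟩
  have h1 := (Finset.sum_eq_sum_iff_of_le hterm).1 (hdiff.trans heq.symm) i (Finset.mem_univ i)
  rw [← inv_smul_dotProduct_mul (hα i) p (x i), ← mul_sub] at h1
  have := mul_left_cancel₀ (hα i).ne' h1
  linarith

/-- For positive weights the potential has at most one root. -/
theorem IsPotentialRoot.unique (hN : 0 < N) (hu : ∀ i, IsUtility (u i)) (hα : ∀ i, 0 < α i)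
    {w : Fin K → ℝ} (hw : ∀ k, 0 < w k) {x x' : Fin N → Fin K → ℝ} {p p' : Fin K → ℝ}
    (h : IsPotentialRoot u α w x p) (h' : IsPotentialRoot u α w x' p') : x' = x ∧ p' = p := by
  obtain ⟨hs, hv⟩ := h.isSupported hu hα
  obtain ⟨hs', hv'⟩ := h'.isSupported hu hα
  have gain : ∀ {x x' : Fin N → Fin K → ℝ} {p : Fin K → ℝ}, IsPotentialRoot u α w x p →
      (∀ i, 0 ≤ x' i) → (∀ i, ⊥ < u i (x' i)) → ∀ i ∈ Finset.univ,
      α i * (u i (x' i)).toReal - p ⬝ᵥ x' i ≤ α i * (u i (x i)).toReal - p ⬝ᵥ x i := by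
    intro x x' p h hx' hux' i _
    have h1 := mul_le_mul_of_nonneg_left (((h.isSupported hu hα).1 i).le (x' i) (hx' i) (hux' i))
      (hα i).le
    rwa [mul_sub, mul_sub, inv_smul_dotProduct_mul (hα i), inv_smul_dotProduct_mul (hα i)] at h1
  have cheap : ∀ {x : Fin N → Fin K → ℝ} {p : Fin K → ℝ}, 0 ≤ p → x ∈ feasible w →
      ∑ i, p ⬝ᵥ x i ≤ p ⬝ᵥ w := by
    intro x p hp hx
    rw [← dotProduct_sum]
    refine Finset.sum_le_sum fun k _ => mul_le_mul_of_nonneg_left ?_ (hp k)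
    rw [Finset.sum_apply]
    exact hx.2 k
  have g1 := gain h (fun i => (hs' i).nonneg) fun i => (hs' i).bot_lt
  have g2 := gain h' (fun i => (hs i).nonneg) fun i => (hs i).bot_lt
  have s1 := Finset.sum_le_sum g1
  have s2 := Finset.sum_le_sum g2
  have c1 := cheap h.2.1 h'.1
  have c2 := cheap h'.2.1 h.1
  -- Each allocation is optimal at its own prices and there costs at least as much as the other, so
  -- both have the same weighted utility. Hence `x'` is also optimal at the prices `p`.
  have hsum : ∑ i, (α i * (u i (x' i)).toReal - p ⬝ᵥ x' i) =
      ∑ i, (α i * (u i (x i)).toReal - p ⬝ᵥ x i) := by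
    simp only [Finset.sum_sub_distrib] at s1 s2 ⊢
    linarith
  have hx : x' = x := by
    funext i
    have h1 := (Finset.sum_eq_sum_iff_of_le g1).1 hsum i (Finset.mem_univ i)
    rw [← inv_smul_dotProduct_mul (hα i) p (x i), ← inv_smul_dotProduct_mul (hα i) p (x' i),
      ← mul_sub, ← mul_sub] at h1
    exact ((hs i).eq_of_le (hu i) (hs' i).nonneg (hs' i).bot_lt
      (mul_left_cancel₀ (hα i).ne' h1).ge).symm
  subst hx
  refine ⟨rfl, funext fun k => ?_⟩
  have hpk : ∀ k, 0 < p k := fun k => by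
    have := (hs ⟨0, hN⟩).price_pos (hu _) k
    rw [Pi.smul_apply, smul_eq_mul] at this
    exact (pos_iff_pos_of_mul_pos this).1 (inv_pos.2 (hα _))
  have hclear : ∑ i, x' i k = w k := by
    have h1 : ∑ k, p k * ∑ i, x' i k = ∑ k, p k * w k := by
      rw [← dotProduct_sum] at hv
      simpa [dotProduct] using hv
    have h2 := (Finset.sum_eq_sum_iff_of_le fun k _ =>
      mul_le_mul_of_nonneg_left (h.1.2 k) (hpk k).le).1 h1 k (Finset.mem_univ k)
    exact mul_left_cancel₀ (hpk k).ne' h2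
  -- Good `k` is used up and `w k > 0`, so some consumer has a positive amount of it; the
  -- first-order condition there determines `p k`.
  obtain ⟨i, -, hi⟩ := Finset.exists_lt_of_sum_lt (f := fun _ => (0 : ℝ)) (g := fun i => x' i k)
    (s := Finset.univ) (by simpa [hclear] using hw k)
  have h1 := ((hs i).price_eq (hu i) hi).trans ((hs' i).price_eq (hu i) hi).symm
  exact (mul_left_cancel₀ (inv_pos.2 (hα i)).ne' h1).symm

end Potential

/-! ### The equilibrium as the unique root. -/

theorem corollary3 {N K : ℕ} (hN : 0 < N)
    (u : Fin N → (Fin K → ℝ) → EReal) (hu : ∀ i, IsUtility (u i))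
    (ω : Fin N → Fin K → ℝ) (hω : ∀ i k, 0 < ω i k) :
    ∃ α ∈ stdSimplex ℝ (Fin N), (∀ i, 0 < α i) ∧
      ∃ (x : Fin N → Fin K → ℝ) (p : Fin K → ℝ),
        IsPotentialRoot u α (totalEndowment ω) x p ∧
        (∀ x' p', IsPotentialRoot u α (totalEndowment ω) x' p' → x' = x ∧ p' = p) ∧
        IsWalrasianEquilibrium u ω x p := by
  obtain ⟨x, p, hE, hux, hp⟩ := exists_isWalrasianEquilibrium hN hu hω
  have hne : (Finset.univ : Finset (Fin N)).Nonempty := ⟨⟨0, hN⟩, Finset.mem_univ _⟩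
  choose l hl hs using fun i => (hu i).exists_multiplier (hω i) hp (hE.bundle_nonneg i) (hux i)
    (hE.budget i) (hE.optimal i)
  -- Dividing the weights `(l i)⁻¹` and the prices by the same `S` normalizes the weights and keeps
  -- the supporting prices `l i • p`.
  set S := ∑ i, (l i)⁻¹ with hS
  have hSpos : 0 < S := Finset.sum_pos (fun i _ => inv_pos.2 (hl i)) hne
  have hα : ∀ i, 0 < (l i)⁻¹ / S := fun i => div_pos (inv_pos.2 (hl i)) hSpos
  have hw : ∀ k, 0 < totalEndowment ω k := fun k => by
    rw [totalEndowment, Finset.sum_apply]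
    exact Finset.sum_pos (fun i _ => hω i k) hne
  have hroot : IsPotentialRoot u (fun i => (l i)⁻¹ / S) (totalEndowment ω) x (S⁻¹ • p) := by
    refine isPotentialRoot_of_isSupported hu hα (smul_nonneg (inv_pos.2 hSpos).le
      hE.price_nonneg) hE.market_clearing fun i => ?_
    have : ((l i)⁻¹ / S)⁻¹ • S⁻¹ • p = l i • p := by
      rw [smul_smul, inv_div, div_inv_eq_mul, mul_comm S, mul_assoc, mul_inv_cancel₀ hSpos.ne',
        mul_one]
    rw [this]
    exact hs i
  have hscale : ∀ y z : Fin K → ℝ, (S⁻¹ • p) ⬝ᵥ y ≤ (S⁻¹ • p) ⬝ᵥ z ↔ p ⬝ᵥ y ≤ p ⬝ᵥ z :=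
    fun y z => by
      rw [smul_dotProduct, smul_dotProduct, smul_eq_mul, smul_eq_mul,
        mul_le_mul_iff_right₀ (inv_pos.2 hSpos)]
  refine ⟨fun i => (l i)⁻¹ / S, ⟨fun i => (hα i).le, ?_⟩, hα, x, S⁻¹ • p, hroot,
    fun x' p' h' => hroot.unique hN hu hα hw h', ?_⟩
  · rw [← Finset.sum_div, div_self hSpos.ne']
  · exact ⟨hroot.2.1, hE.bundle_nonneg, fun i => (hscale _ _).2 (hE.budget i),
      fun i y hy hpy => hE.optimal i y hy ((hscale _ _).1 hpy), hE.market_clearing⟩
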